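/- Let $A$ be a unital C*-algebra with trivial center, i.e. $Z(A)=\mathbb{C}1_A$, and let $G$ be an amenable discrete group. Let $(\alpha,\omega)$ be a twisted action of $G$ on $A$, i.e. maps $\alpha:G\to\mathrm{Aut}(A)$ and $\omega:G\times G\to\mathcal{U}(A)$ with $$\alpha_s\alpha_t=\mathrm{Ad}(\omega(s,t))\,\alpha_{st},\qquad \omega(r,s)\,\omega(rs,t)=\alpha_r(\omega(s,t))\,\omega(r,st),\qquad \alpha_e=\mathrm{id},\quad \omega(e,s)=\omega(s,e)=1$$ for all $r,s,t\in G$. Suppose that the action is pointwise inner: for every $s\in G$ there is a unitary $v\in A$ with $\alpha_s=\mathrm{Ad}(v)$. Then there is a normalized 2-cocycle $\sigma\in Z^2(G,\mathbb{T})$, i.e. a map $\sigma:G\times G\to\mathbb{T}$ with $\sigma(r,s)\sigma(rs,t)=\sigma(s,t)\sigma(r,st)$ and $\sigma(e,s)=\sigma(s,e)=1$, and a $*$-isomorphism $$A\rtimes_{\alpha,\omega}G\;\cong\;A\otimes_{\min}C^*_r(G,\sigma).$$ Here $A\rtimes_{\alpha,\omega}G$ is the reduced twisted crossed product: for a faithful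 unital representation $\pi$ of $A$ on a Hilbert space $H$, it is the C*-algebra on $\ell^2(G,H)$ generated by the operators $(\pi_\alpha(a)\xi)(h)=\pi(\alpha_{h^{-1}}(a))\xi(h)$, $a\in A$, and $(\lambda(g)\xi)(h)=\pi(\omega(h^{-1},g))\,\xi(g^{-1}h)$, $g\in G$ (up to isomorphism it does not depend on $\pi$). $C^*_r(G,\sigma)=\mathbb{C}\rtimes_{\mathrm{id},\sigma}G$ is the reduced twisted group C*-algebra, and $\otimes_{\min}$ is the minimal (spatial) C*-tensor product. -/

import Mathlib

open scoped ComplexOrder TensorProduct ENNReal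

universe u v w u' v'

noncomputable section

/-! ### Operators and representations on Hilbert sums -/

namespace HilbertSum

variable {ι : Type w} {E : ι → Type u} [∀ i, NormedAddCommGroup (E i)]
  [∀ i, InnerProductSpace ℂ (E i)]

theorem memℓp_weighted (e : ι ≃ ι) (T : ∀ i, E (e i) →L[ℂ] E i) (C : ℝ)
    (hT : ∀ i, ‖T i‖ ≤ C) (x : lp E 2) : Memℓp (fun i => T i (x (e i))) 2 := by
  apply memℓp_gen
  have hx : Summable fun i => ‖x i‖ ^ (2 : ℝ≥0∞).toReal := (lp.memℓp x).summable (by simp)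
  have hx' : Summable fun i => C ^ 2 * ‖x (e i)‖ ^ (2 : ℝ≥0∞).toReal :=
    (e.summable_iff.mpr hx).mul_left _
  refine Summable.of_nonneg_of_le (fun i => by positivity) (fun i => ?_) hx'
  have h1 : ‖T i (x (e i))‖ ≤ C * ‖x (e i)‖ :=
    (T i).le_of_opNorm_le (hT i) _
  have h2 : (2 : ℝ≥0∞).toReal = ((2 : ℕ) : ℝ) := by simp
  rw [h2, Real.rpow_natCast, Real.rpow_natCast, ← mul_pow]
  exact pow_le_pow_left₀ (norm_nonneg _) h1 2

/-- For a permutation `e` of `ι` and operators `T i : E (e i) → E i` with `‖T i‖ ≤ C`, the bounded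
operator `(x i)_i ↦ (T i (x (e i)))_i` on the Hilbert sum `⨁ᵢ E i`. -/
def weighted (e : ι ≃ ι) (T : ∀ i, E (e i) →L[ℂ] E i) (C : ℝ) (hT : ∀ i, ‖T i‖ ≤ C) :
    lp E 2 →L[ℂ] lp E 2 :=
  LinearMap.mkContinuous
    { toFun := fun x => ⟨fun i => T i (x (e i)), memℓp_weighted e T C hT x⟩
      map_add' := fun x y => by ext i; exact map_add (T i) _ _
      map_smul' := fun c x => by ext i; exact map_smul (T i) _ _ }
    (max C 0) (fun x => by
      refine lp.norm_le_of_tsum_le (p := 2) (by simp) (by positivity) ?_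
      have hx : Summable fun i => ‖x i‖ ^ (2 : ℝ≥0∞).toReal := (lp.memℓp x).summable (by simp)
      have h2 : (2 : ℝ≥0∞).toReal = ((2 : ℕ) : ℝ) := by simp
      have hle : ∀ i, ‖T i (x (e i))‖ ^ (2 : ℝ≥0∞).toReal ≤
          (max C 0) ^ 2 * ‖x (e i)‖ ^ (2 : ℝ≥0∞).toReal := fun i => by
        have h1 : ‖T i (x (e i))‖ ≤ max C 0 * ‖x (e i)‖ :=
          (T i).le_of_opNorm_le ((hT i).trans (le_max_left _ _)) _
        rw [h2, Real.rpow_natCast, Real.rpow_natCast, ← mul_pow]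
        exact pow_le_pow_left₀ (norm_nonneg _) h1 2
      have hs := (memℓp_weighted e T C hT x).summable (by simp)
      calc ∑' i, ‖T i (x (e i))‖ ^ (2 : ℝ≥0∞).toReal
          ≤ ∑' i, (max C 0) ^ 2 * ‖x (e i)‖ ^ (2 : ℝ≥0∞).toReal :=
            hs.tsum_le_tsum hle ((e.summable_iff.mpr hx).mul_left _)
        _ = (max C 0) ^ 2 * ∑' i, ‖x i‖ ^ (2 : ℝ≥0∞).toReal := by
            rw [tsum_mul_left, e.tsum_eq (fun i => ‖x i‖ ^ (2 : ℝ≥0∞).toReal)]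
        _ = (max C 0 * ‖x‖) ^ (2 : ℝ≥0∞).toReal := by
            rw [Real.mul_rpow (by positivity) (by positivity),
              lp.norm_rpow_eq_tsum (by simp) x, h2, Real.rpow_natCast])

@[simp]
theorem weighted_apply (e : ι ≃ ι) (T : ∀ i, E (e i) →L[ℂ] E i) (C : ℝ) (hT : ∀ i, ‖T i‖ ≤ C)
    (x : lp E 2) (i : ι) : weighted e T C hT x i = T i (x (e i)) := rfl

/-- The diagonal operator `(x i)_i ↦ (T i (x i))_i` on the Hilbert sum `⨁ᵢ E i`. -/
def diag (T : ∀ i, E i →L[ℂ] E i) (C : ℝ) (hT : ∀ i, ‖T i‖ ≤ C) : lp E 2 →L[ℂ] lp E 2 :=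
  weighted (Equiv.refl ι) T C hT

@[simp]
theorem diag_apply (T : ∀ i, E i →L[ℂ] E i) (C : ℝ) (hT : ∀ i, ‖T i‖ ≤ C)
    (x : lp E 2) (i : ι) : diag T C hT x i = T i (x i) := rfl

variable [∀ i, CompleteSpace (E i)] {A : Type v} [CStarAlgebra A]

/-- The Hilbert sum `⨁ᵢ π i` of a family of unital `*`-representations `π i` of `A` on `E i`. -/
def rep (π : ∀ i, A →⋆ₐ[ℂ] (E i →L[ℂ] E i)) : A →⋆ₐ[ℂ] (lp E 2 →L[ℂ] lp E 2) where
  toFun a := diag (fun i => π i a) ‖a‖ (fun i => NonUnitalStarAlgHom.norm_apply_le (π i) a)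
  map_one' := by ext x i; simp
  map_mul' a b := by ext x i; simp
  map_zero' := by ext x i; simp
  map_add' a b := by ext x i; simp
  commutes' c := by ext x i; simp [Algebra.algebraMap_eq_smul_one]
  map_star' a := by
    rw [ContinuousLinearMap.star_eq_adjoint, ContinuousLinearMap.eq_adjoint_iff]
    intro x y
    rw [lp.inner_eq_tsum, lp.inner_eq_tsum]
    refine tsum_congr fun i => ?_
    simp only [diag_apply, map_star, ContinuousLinearMap.star_eq_adjoint,
      ContinuousLinearMap.adjoint_inner_left]

@[simp]
theorem rep_apply (π : ∀ i, A →⋆ₐ[ℂ] (E i →L[ℂ] E i)) (a : A) (x : lp E 2) (i : ι) :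
    rep π a x i = π i a (x i) := rfl

end HilbertSum

/-! ### The universal representation of a C⋆-algebra -/

section Universal

variable (A : Type u) [CStarAlgebra A]

/-- The positive linear functionals on the C⋆-algebra `A` (for its canonical order). -/
abbrev PosFunctional : Type u :=
  letI := CStarAlgebra.spectralOrder A
  A →ₚ[ℂ] ℂ

/-- The GNS Hilbert space of a positive functional. -/
abbrev gnsSpace (f : PosFunctional A) : Type u :=
  letI := CStarAlgebra.spectralOrder A
  letI := CStarAlgebra.spectralOrderedRing A
  PositiveLinearMap.GNS f

/-- The GNS representation of a positive functional. -/
def gnsRep (f : PosFunctional A) : A →⋆ₐ[ℂ] (gnsSpace A f →L[ℂ] gnsSpace A f) :=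
  letI := CStarAlgebra.spectralOrder A
  letI := CStarAlgebra.spectralOrderedRing A
  PositiveLinearMap.gnsStarAlgHom f

/-- The Hilbert space of the universal representation of `A`: the Hilbert sum of the GNS spaces of
all positive functionals on `A`. -/
abbrev UniversalSpace : Type u := lp (gnsSpace A) 2

/-- The universal representation of `A`: the Hilbert sum of the GNS representations of all positive
functionals on `A`. -/
def universalRep : A →⋆ₐ[ℂ] (UniversalSpace A →L[ℂ] UniversalSpace A) :=
  HilbertSum.rep (gnsRep A)

theorem universalRep_apply (a : A) (x : UniversalSpace A) (f : PosFunctional A) :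
    universalRep A a x f = gnsRep A f a (x f) := rfl

/-- Positive functionals separate the nonzero positive elements `a⋆ a` from `0`. -/
theorem exists_posFunctional {a : A} (ha : a ≠ 0) :
    ∃ f : PosFunctional A, f (star a * a) ≠ 0 := by
  let _ := CStarAlgebra.spectralOrder A
  have := CStarAlgebra.spectralOrderedRing A
  let C : ProperCone ℝ A := ProperCone.positive ℝ A
  have hneg : -(star a * a) ∉ C := by
    intro h
    have h0 : 0 ≤ -(star a * a) := h
    have h1 : star a * a = 0 := le_antisymm (neg_nonneg.mp h0) (star_mul_self_nonneg a)
    exact ha (CStarRing.star_mul_self_eq_zero_iff a |>.mp h1)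
  obtain ⟨g, hg, hga⟩ := C.hyperplane_separation_point hneg
  let g' : A →ₗ[ℝ] ℝ :=
    g.toLinearMap ∘ₗ (selfAdjoint.submodule ℝ A).subtype ∘ₗ realPart
  have hval : ∀ x : A, IsSelfAdjoint x →
      Module.Dual.extendRCLike (𝕜 := ℂ) g' x = (g x : ℂ) := fun x hx => by
    have h1 : g' x = g x := by
      change g ((realPart x : selfAdjoint A) : A) = g x
      rw [hx.coe_realPart]
    have h2 : g' (Complex.I • x) = 0 := by
      change g ((realPart (Complex.I • x) : selfAdjoint A) : A) = 0
      rw [realPart_I_smul, hx.imaginaryPart]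
      simp
    rw [Module.Dual.extendRCLike_apply]
    simp [h1, h2]
  refine ⟨PositiveLinearMap.mk₀ (Module.Dual.extendRCLike (𝕜 := ℂ) g') fun x hx => ?_, ?_⟩
  · rw [hval x (IsSelfAdjoint.of_nonneg hx)]
    exact Complex.zero_le_real.mpr (hg x hx)
  · change Module.Dual.extendRCLike (𝕜 := ℂ) g' (star a * a) ≠ 0
    rw [hval _ (IsSelfAdjoint.star_mul_self a)]
    rw [map_neg] at hga
    exact_mod_cast (by linarith : (0 : ℝ) < g (star a * a)).ne'

/-- The universal representation is faithful. -/
theorem universalRep_injective : Function.Injective (universalRep A) := by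
  let _ := CStarAlgebra.spectralOrder A
  have := CStarAlgebra.spectralOrderedRing A
  rw [injective_iff_map_eq_zero]
  intro a ha
  by_contra hne
  obtain ⟨f, hf⟩ := exists_posFunctional A hne
  apply hf
  classical
  have h1 : gnsRep A f a ((PositiveLinearMap.toPreGNS f 1 : PositiveLinearMap.PreGNS f) :
      gnsSpace A f) = 0 := by
    have h := congrArg (fun y : UniversalSpace A => y f)
      (congrArg (fun S => S (lp.single (E := gnsSpace A) 2 f
        ((PositiveLinearMap.toPreGNS f 1 : PositiveLinearMap.PreGNS f) : gnsSpace A f))) ha)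
    simpa [universalRep_apply] using h
  have h2 : ((PositiveLinearMap.toPreGNS f a : PositiveLinearMap.PreGNS f) :
      gnsSpace A f) = 0 := by
    rw [← h1]
    simp [gnsRep]
  have h3 : ‖PositiveLinearMap.toPreGNS f a‖ = 0 := by
    rw [← UniformSpace.Completion.norm_coe, h2, norm_zero]
  have h4 := PositiveLinearMap.preGNS_norm_sq f (PositiveLinearMap.toPreGNS f a)
  rw [h3] at h4
  simpa using h4.symm

end Universal

/-! ### The minimal tensor product -/

section MinTensor

/-- The Hilbert space tensor product of `H` and `K`: the completion of `H ⊗ K`. -/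
def HilbertTensor (H : Type u) (K : Type v) [NormedAddCommGroup H] [InnerProductSpace ℂ H]
    [NormedAddCommGroup K] [InnerProductSpace ℂ K] : Type max u v :=
  UniformSpace.Completion (H ⊗[ℂ] K)

section

variable (H : Type u) (K : Type v) [NormedAddCommGroup H] [InnerProductSpace ℂ H]
  [NormedAddCommGroup K] [InnerProductSpace ℂ K]

instance : NormedAddCommGroup (HilbertTensor H K) :=
  inferInstanceAs (NormedAddCommGroup (UniformSpace.Completion (H ⊗[ℂ] K)))

instance : InnerProductSpace ℂ (HilbertTensor H K) :=
  inferInstanceAs (InnerProductSpace ℂ (UniformSpace.Completion (H ⊗[ℂ] K)))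

instance : CompleteSpace (HilbertTensor H K) :=
  inferInstanceAs (CompleteSpace (UniformSpace.Completion (H ⊗[ℂ] K)))

end

/-- The bounded operator `S ⊗ T` on the Hilbert space tensor product. -/
def operatorTensor {H : Type u} {K : Type v} [NormedAddCommGroup H] [InnerProductSpace ℂ H]
    [NormedAddCommGroup K] [InnerProductSpace ℂ K] (S : H →L[ℂ] H) (T : K →L[ℂ] K) :
    HilbertTensor H K →L[ℂ] HilbertTensor H K :=
  (TensorProduct.mapL S T).completion

/-- The spatial tensor product of `π(A) ⊆ B(H)` and `ρ(B) ⊆ B(K)`: the norm closure in `B(H ⊗ K)` of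
the `*`-algebra generated by (equivalently, the linear span of) the operators `π(a) ⊗ ρ(b)`. -/
def spatialTensor {A : Type u} {B : Type v} [CStarAlgebra A] [CStarAlgebra B]
    {H : Type u'} {K : Type v'} [NormedAddCommGroup H] [InnerProductSpace ℂ H] [CompleteSpace H]
    [NormedAddCommGroup K] [InnerProductSpace ℂ K] [CompleteSpace K]
    (π : A →⋆ₐ[ℂ] (H →L[ℂ] H)) (ρ : B →⋆ₐ[ℂ] (K →L[ℂ] K)) :
    StarSubalgebra ℂ (HilbertTensor H K →L[ℂ] HilbertTensor H K) :=
  (StarAlgebra.adjoin ℂ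
    (Set.range fun p : A × B => operatorTensor (π p.1) (ρ p.2))).topologicalClosure

theorem isClosed_spatialTensor {A : Type u} {B : Type v} [CStarAlgebra A] [CStarAlgebra B]
    {H : Type u'} {K : Type v'} [NormedAddCommGroup H] [InnerProductSpace ℂ H] [CompleteSpace H]
    [NormedAddCommGroup K] [InnerProductSpace ℂ K] [CompleteSpace K]
    (π : A →⋆ₐ[ℂ] (H →L[ℂ] H)) (ρ : B →⋆ₐ[ℂ] (K →L[ℂ] K)) :
    IsClosed (spatialTensor π ρ : Set (HilbertTensor H K →L[ℂ] HilbertTensor H K)) :=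
  StarSubalgebra.isClosed_topologicalClosure _

/-- The minimal (spatial) tensor product `A ⊗_min B` of two unital C⋆-algebras: the spatial tensor
product formed in the universal representations of `A` and `B`, which are faithful. -/
abbrev MinTensor (A : Type u) (B : Type v) [CStarAlgebra A] [CStarAlgebra B] : Type max u v :=
  spatialTensor (universalRep A) (universalRep B)

instance (A : Type u) (B : Type v) [CStarAlgebra A] [CStarAlgebra B] :
    CStarAlgebra (MinTensor A B) :=
  StarSubalgebra.cstarAlgebra (h_closed := isClosed_spatialTensor _ _) _

end MinTensor

/-! ### Twisted actions and reduced twisted crossed products -/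

/-- A twisted action `(α, ω)` of a discrete group `G` on a unital C⋆-algebra `A`. -/
structure TwistedAction (G : Type v) (A : Type u) [Group G] [CStarAlgebra A] where
  /-- the automorphisms `α_s` -/
  aut : G → (A ≃⋆ₐ[ℂ] A)
  /-- the unitary valued cocycle `ω(s, t)` -/
  cocycle : G → G → unitary A
  aut_one : ∀ a, aut 1 a = a
  aut_aut : ∀ s t a,
    aut s (aut t a) = (cocycle s t : A) * aut (s * t) a * star (cocycle s t : A)
  cocycle_mul : ∀ r s t,
    (cocycle r s : A) * cocycle (r * s) t = aut r (cocycle s t : A) * cocycle r (s * t)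
  cocycle_one_left : ∀ s, cocycle 1 s = 1
  cocycle_one_right : ∀ s, cocycle s 1 = 1

namespace TwistedAction

variable {G : Type v} {A : Type u} [Group G] [CStarAlgebra A] (T : TwistedAction G A)

/-- Every single automorphism `α_s` is inner: `α_s = Ad v` for some unitary `v ∈ A`. -/
def PointwiseInner : Prop :=
  ∀ s, ∃ v : unitary A, ∀ a, T.aut s a = (v : A) * a * star (v : A)

section Regular

variable {H : Type w} [NormedAddCommGroup H] [InnerProductSpace ℂ H] [CompleteSpace H]
  (π : A →⋆ₐ[ℂ] (H →L[ℂ] H))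

/-- The representation of `A` on `ℓ²(G, H)` given by `(π_α(a) ξ)(h) = π(α_{h⁻¹}(a)) ξ(h)`. -/
def regularRep : A →⋆ₐ[ℂ] (lp (fun _ : G => H) 2 →L[ℂ] lp (fun _ : G => H) 2) :=
  HilbertSum.rep fun h => π.comp (T.aut h⁻¹ : A →⋆ₐ[ℂ] A)

theorem norm_cocycle_le (s t : G) : ‖π (T.cocycle s t : A)‖ ≤ 1 := by
  refine (NonUnitalStarAlgHom.norm_apply_le π _).trans ?_
  rcases subsingleton_or_nontrivial A with h | h
  · rw [Subsingleton.elim (T.cocycle s t : A) 0, norm_zero]; exact zero_le_one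
  · exact (CStarRing.norm_coe_unitary _).le

/-- The operators on `ℓ²(G, H)` given by `(λ(g) ξ)(h) = π(ω(h⁻¹, g)) ξ(g⁻¹ h)`. -/
def regularUnitary (g : G) : lp (fun _ : G => H) 2 →L[ℂ] lp (fun _ : G => H) 2 :=
  HilbertSum.weighted (E := fun _ : G => H) (Equiv.mulLeft g⁻¹)
    (fun h => π (T.cocycle h⁻¹ g : A)) 1 (fun h => T.norm_cocycle_le π h⁻¹ g)

/-- The C⋆-algebra on `ℓ²(G, H)` generated by `π_α(A)` and the `λ(g)`, `g ∈ G`. For faithful `π` it is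
the reduced twisted crossed product. -/
def regularAlgebra :
    StarSubalgebra ℂ (lp (fun _ : G => H) 2 →L[ℂ] lp (fun _ : G => H) 2) :=
  (StarAlgebra.adjoin ℂ
    (Set.range (T.regularRep π) ∪ Set.range (T.regularUnitary π))).topologicalClosure

theorem isClosed_regularAlgebra : IsClosed (T.regularAlgebra π :
    Set (lp (fun _ : G => H) 2 →L[ℂ] lp (fun _ : G => H) 2)) :=
  StarSubalgebra.isClosed_topologicalClosure _

end Regular

/-- The reduced twisted crossed product `A ⋊_{α,ω} G`, formed on `ℓ²(G, H)` with `H` the space of the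
universal representation of `A`, which is faithful. -/
abbrev CrossedProduct : Type max u v := T.regularAlgebra (universalRep A)

instance : CStarAlgebra T.CrossedProduct :=
  StarSubalgebra.cstarAlgebra (h_closed := T.isClosed_regularAlgebra _) _

end TwistedAction

/-! ### Twisted group C⋆-algebras -/

/-- A (normalized) `𝕋`-valued 2-cocycle on the group `G`, for the trivial action of `G` on `𝕋`. -/
structure TwoCocycle (G : Type v) [Group G] where
  /-- the values `σ(s, t)` -/
  toFun : G → G → Circle
  mul_eq : ∀ r s t, toFun r s * toFun (r * s) t = toFun s t * toFun r (s * t)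
  one_left : ∀ s, toFun 1 s = 1
  one_right : ∀ s, toFun s 1 = 1

namespace TwoCocycle

variable {G : Type v} [Group G] (σ : TwoCocycle G)

theorem star_mul_coe (z : Circle) : star (z : ℂ) * (z : ℂ) = 1 := by
  rw [← starRingEnd_apply, ← Circle.coe_inv_eq_conj, ← Circle.coe_mul, inv_mul_cancel,
    Circle.coe_one]

/-- A `𝕋`-valued 2-cocycle as a twisted action of `G` on `ℂ`, with trivial automorphisms. -/
def twistedAction : TwistedAction G ℂ where
  aut _ := StarAlgEquiv.refl ℂ ℂ
  cocycle s t := ⟨σ.toFun s t, by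
    rw [Unitary.mem_iff]
    exact ⟨star_mul_coe _, (mul_comm _ _).trans (star_mul_coe _)⟩⟩
  aut_one _ := rfl
  aut_aut s t a := by
    have h := star_mul_coe (σ.toFun s t)
    change a = (σ.toFun s t : ℂ) * a * star (σ.toFun s t : ℂ)
    rw [mul_right_comm, mul_comm (σ.toFun s t : ℂ), h, one_mul]
  cocycle_mul r s t := by
    exact congrArg (fun z : Circle => (z : ℂ)) (σ.mul_eq r s t)
  cocycle_one_left s :=
    Subtype.ext (congrArg (fun z : Circle => (z : ℂ)) (σ.one_left s))
  cocycle_one_right s :=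
    Subtype.ext (congrArg (fun z : Circle => (z : ℂ)) (σ.one_right s))

/-- The reduced twisted group C⋆-algebra `C*_r(G, σ) = ℂ ⋊_{id,σ} G`, acting on `ℓ²(G)`. -/
abbrev GroupCStar : Type v :=
  σ.twistedAction.regularAlgebra (StarAlgHom.ofId ℂ (ℂ →L[ℂ] ℂ))

instance : CStarAlgebra σ.GroupCStar :=
  StarSubalgebra.cstarAlgebra (h_closed := σ.twistedAction.isClosed_regularAlgebra _) _

end TwoCocycle

/-- A discrete group `G` is amenable if it carries a finitely additive left invariant probability
measure, defined on all subsets. -/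
def IsAmenable (G : Type v) [Group G] : Prop :=
  ∃ m : Set G → ℝ, (∀ S, 0 ≤ m S) ∧ m Set.univ = 1 ∧
    (∀ S S', Disjoint S S' → m (S ∪ S') = m S + m S') ∧
    ∀ (g : G) (S : Set G), m ((fun x => g * x) '' S) = m S

end

/-! Choose unitaries `v s` implementing `α_s`, with `v 1 = 1`. Both `v s * v t` and `ω(s,t) * v (s *
t)` implement `α_s α_t`, so they differ by a central unitary, hence by a scalar `σ(s,t)` of modulus
one: `ω(s,t) v_{st} = σ(s,t) v_s v_t`. The twist identity for `ω` then becomes the cocycle identity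
for `σ`.

The unitary `U : H ⊗ ℓ²(G) → ℓ²(G, H)`, `x ⊗ f ↦ (f(h) π(v_{h⁻¹}) x)_h`, conjugates `π(a) ⊗ 1` to
`π_α(a)` and `π(v_g) ⊗ λ_σ(g)` to `λ(g)`. Since `v_g` lies in `A`, it can be cancelled from the
first leg, so these operators generate the spatial tensor product of `π(A)` with `C*_r(G, σ)` acting
on `ℓ²(G)` (`topologicalClosure_map_range_tensorRep`).

The minimal tensor product instead represents `C*_r(G, σ)` universally, so the spatial norm must be
shown independent of the faithful representation `ρ` of the second factor (`norm_tensorRep_eq`). It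
is a supremum of norms of matrices over `B`, one for each finite orthonormal family in `H`; a
faithful representation of `B` gives a faithful, hence isometric, one of `M_n(B)`, so `ρ` drops out.
-/

/-! ### Isometric `*`-homomorphisms and closures -/

namespace StarSubalgebra

variable {C : Type u} {D : Type v} [CStarAlgebra C] [CStarAlgebra D]

open scoped CStarAlgebra in
/-- A `*`-homomorphism that is isometric on a `*`-subalgebra `S` identifies the closure of `S` with
the closure of the image of `S`. -/
theorem nonempty_starAlgEquiv_topologicalClosure_map (S : StarSubalgebra ℂ C) (f : C →⋆ₐ[ℂ] D)
    (hf : ∀ x ∈ S, ‖f x‖ = ‖x‖) :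
    Nonempty (S.topologicalClosure ≃⋆ₐ[ℂ] (S.map f).topologicalClosure) := by
  have hcont : Continuous f := map_continuous f
  have hnorm : ∀ x ∈ S.topologicalClosure, ‖f x‖ = ‖x‖ := fun x hx =>
    closure_minimal (s := (S : Set C)) (t := {x | ‖f x‖ = ‖x‖}) hf
      (isClosed_eq (hcont.norm) continuous_norm) hx
  let g : S.topologicalClosure →⋆ₐ[ℂ] (S.map f).topologicalClosure :=
    StarAlgHom.codRestrict (f.comp S.topologicalClosure.subtype) _ fun x =>
      map_topologicalClosure_le S f hcont ⟨x, x.2, rfl⟩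
  have hg : Isometry g := AddMonoidHomClass.isometry_of_norm g fun x => hnorm x x.2
  refine ⟨StarAlgEquiv.ofBijective g ⟨hg.injective, ?_⟩⟩
  -- An isometry from a complete space has closed range; containing `f(S)`, the range contains its
  -- closure, which gives surjectivity.
  have hclosed : IsClosed (Set.range fun x => (g x : D)) :=
    (isometry_subtype_coe.comp hg).isClosedEmbedding.isClosed_range
  rintro ⟨y, hy⟩
  have hsub : ((S.map f : StarSubalgebra ℂ D) : Set D) ⊆ Set.range fun x => (g x : D) := by
    rintro _ ⟨x, hx, rfl⟩
    exact ⟨⟨x, S.le_topologicalClosure hx⟩, rfl⟩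
  obtain ⟨x, hx⟩ := closure_minimal hsub hclosed hy
  exact ⟨x, Subtype.ext hx⟩

end StarSubalgebra

namespace StarAlgHom

variable {X : Type w} {C : Type u} {D : Type v} [Ring X] [StarRing X] [Algebra ℂ X]
  [CStarAlgebra C] [CStarAlgebra D]

/-- Two `*`-representations with the same norms generate isomorphic C⋆-algebras. -/
theorem nonempty_starAlgEquiv_of_norm_eq (φ : X →⋆ₐ[ℂ] C) (ψ : X →⋆ₐ[ℂ] D)
    (h : ∀ x, ‖φ x‖ = ‖ψ x‖) :
    Nonempty (φ.range.topologicalClosure ≃⋆ₐ[ℂ] ψ.range.topologicalClosure) := by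
  -- The closures are compared through the algebra of pairs `(φ x, ψ x)` in `C × D` with the max
  -- norm: equality of norms makes both coordinate projections isometric on it.
  have h1 : (φ.prod ψ).range.map (StarAlgHom.fst ℂ C D) = φ.range := by
    ext y
    constructor
    · rintro ⟨_, ⟨x, rfl⟩, rfl⟩; exact ⟨x, rfl⟩
    · rintro ⟨x, rfl⟩; exact ⟨_, ⟨x, rfl⟩, rfl⟩
  have h2 : (φ.prod ψ).range.map (StarAlgHom.snd ℂ C D) = ψ.range := by
    ext y
    constructor
    · rintro ⟨_, ⟨x, rfl⟩, rfl⟩; exact ⟨x, rfl⟩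
    · rintro ⟨x, rfl⟩; exact ⟨_, ⟨x, rfl⟩, rfl⟩
  obtain ⟨e₁⟩ := StarSubalgebra.nonempty_starAlgEquiv_topologicalClosure_map (φ.prod ψ).range
    (StarAlgHom.fst ℂ C D) (by
      rintro _ ⟨x, rfl⟩
      exact (max_eq_left (h x).ge).symm)
  obtain ⟨e₂⟩ := StarSubalgebra.nonempty_starAlgEquiv_topologicalClosure_map (φ.prod ψ).range
    (StarAlgHom.snd ℂ C D) (by
      rintro _ ⟨x, rfl⟩
      exact (max_eq_right (h x).le).symm)
  rw [h1] at e₁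
  rw [h2] at e₂
  exact ⟨e₁.symm.trans e₂⟩

end StarAlgHom

/-! ### Operators on Hilbert space tensor products -/

namespace HilbertTensor

variable {H : Type u} {K : Type v} [NormedAddCommGroup H] [InnerProductSpace ℂ H]
    [NormedAddCommGroup K] [InnerProductSpace ℂ K]

variable (H K) in
/-- The canonical isometry of the algebraic tensor product into its completion. -/
noncomputable def ofTensor : H ⊗[ℂ] K →ₗᵢ[ℂ] HilbertTensor H K :=
  UniformSpace.Completion.toComplₗᵢ

theorem denseRange_ofTensor : DenseRange (ofTensor H K) :=
  UniformSpace.Completion.denseRange_coe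

/-- Bounded operators on a Hilbert space tensor product are determined by the pure tensors. -/
theorem ext_tmul {E : Type w} [NormedAddCommGroup E] [NormedSpace ℂ E]
    {S T : HilbertTensor H K →L[ℂ] E}
    (h : ∀ x y, S (ofTensor H K (x ⊗ₜ y)) = T (ofTensor H K (x ⊗ₜ y))) : S = T := by
  refine ContinuousLinearMap.ext fun z => congrFun
    (denseRange_ofTensor.equalizer S.continuous T.continuous (funext fun t => ?_)) z
  induction t with
  | zero => simp
  | tmul x y => exact h x y
  | add s t hs ht => simpa using congrArg₂ (· + ·) hs ht

theorem operatorTensor_ofTensor (S : H →L[ℂ] H) (T : K →L[ℂ] K) (t : H ⊗[ℂ] K) :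
    operatorTensor S T (ofTensor H K t) = ofTensor H K (TensorProduct.mapL S T t) :=
  ContinuousLinearMap.completion_apply_coe _ t

@[simp]
theorem operatorTensor_tmul (S : H →L[ℂ] H) (T : K →L[ℂ] K) (x : H) (y : K) :
    operatorTensor S T (ofTensor H K (x ⊗ₜ y)) = ofTensor H K (S x ⊗ₜ T y) :=
  operatorTensor_ofTensor S T _

theorem inner_tmul (x x' : H) (y y' : K) :
    inner ℂ (ofTensor H K (x ⊗ₜ y)) (ofTensor H K (x' ⊗ₜ y')) = inner ℂ x x' * inner ℂ y y' := by
  rw [LinearIsometry.inner_map_map, TensorProduct.inner_tmul]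

theorem operatorTensor_mul (S S' : H →L[ℂ] H) (T T' : K →L[ℂ] K) :
    operatorTensor (S * S') (T * T') = operatorTensor S T * operatorTensor S' T' :=
  ext_tmul fun x y => by simp

theorem operatorTensor_one : operatorTensor (1 : H →L[ℂ] H) (1 : K →L[ℂ] K) = 1 :=
  ext_tmul fun x y => by simp

theorem operatorTensor_add_left (S S' : H →L[ℂ] H) (T : K →L[ℂ] K) :
    operatorTensor (S + S') T = operatorTensor S T + operatorTensor S' T :=
  ext_tmul fun x y => by simp [TensorProduct.add_tmul]

theorem operatorTensor_add_right (S : H →L[ℂ] H) (T T' : K →L[ℂ] K) :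
    operatorTensor S (T + T') = operatorTensor S T + operatorTensor S T' :=
  ext_tmul fun x y => by simp [TensorProduct.tmul_add]

theorem operatorTensor_smul_left (c : ℂ) (S : H →L[ℂ] H) (T : K →L[ℂ] K) :
    operatorTensor (c • S) T = c • operatorTensor S T :=
  ext_tmul fun x y => by simp [← TensorProduct.smul_tmul']

theorem operatorTensor_smul_right (c : ℂ) (S : H →L[ℂ] H) (T : K →L[ℂ] K) :
    operatorTensor S (c • T) = c • operatorTensor S T :=
  ext_tmul fun x y => by simp

theorem star_operatorTensor [CompleteSpace H] [CompleteSpace K]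
    (S : H →L[ℂ] H) (T : K →L[ℂ] K) :
    star (operatorTensor S T) = operatorTensor (star S) (star T) := by
  refine ext_tmul fun x y => ext_inner_right ℂ fun z => ?_
  rw [ContinuousLinearMap.star_eq_adjoint, ContinuousLinearMap.adjoint_inner_left]
  -- With `x ⊗ y` fixed, both sides are bounded linear functionals of `z`, so `z` may also be taken
  -- to be a pure tensor.
  refine DFunLike.congr_fun (f := innerSL ℂ (ofTensor H K (x ⊗ₜ y)) ∘L operatorTensor S T)
    (g := innerSL ℂ (operatorTensor (star S) (star T) (ofTensor H K (x ⊗ₜ y))))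
    (ext_tmul fun x' y' => ?_) z
  simp [ContinuousLinearMap.star_eq_adjoint, ContinuousLinearMap.adjoint_inner_left]

end HilbertTensor

/-! ### The tensor product representation of `A ⊗ B` -/

section TensorRep

open HilbertTensor

variable {A : Type u} {B : Type v} [CStarAlgebra A] [CStarAlgebra B]
    {H : Type u'} {K : Type v'} [NormedAddCommGroup H] [InnerProductSpace ℂ H] [CompleteSpace H]
    [NormedAddCommGroup K] [InnerProductSpace ℂ K] [CompleteSpace K]

/-- The tensor product representation as a homomorphism of algebras. -/
noncomputable def tensorAlgHom (π : A →⋆ₐ[ℂ] (H →L[ℂ] H)) (ρ : B →⋆ₐ[ℂ] (K →L[ℂ] K)) :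
    A ⊗[ℂ] B →ₐ[ℂ] (HilbertTensor H K →L[ℂ] HilbertTensor H K) :=
  Algebra.TensorProduct.algHomOfLinearMapTensorProduct
    (TensorProduct.lift (LinearMap.mk₂ ℂ (fun a b => operatorTensor (π a) (ρ b))
      (fun a a' b => by rw [map_add, operatorTensor_add_left])
      (fun c a b => by rw [map_smul, operatorTensor_smul_left])
      (fun a b b' => by rw [map_add, operatorTensor_add_right])
      (fun c a b => by rw [map_smul, operatorTensor_smul_right])))
    (fun a a' b b' => by simp [operatorTensor_mul])
    (by simp [operatorTensor_one])

theorem tensorAlgHom_tmul (π : A →⋆ₐ[ℂ] (H →L[ℂ] H)) (ρ : B →⋆ₐ[ℂ] (K →L[ℂ] K)) (a : A) (b : B) :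
    tensorAlgHom π ρ (a ⊗ₜ b) = operatorTensor (π a) (ρ b) := rfl

/-- The tensor product representation `a ⊗ b ↦ π(a) ⊗ ρ(b)` of the algebraic tensor product. -/
noncomputable def tensorRep (π : A →⋆ₐ[ℂ] (H →L[ℂ] H)) (ρ : B →⋆ₐ[ℂ] (K →L[ℂ] K)) :
    A ⊗[ℂ] B →⋆ₐ[ℂ] (HilbertTensor H K →L[ℂ] HilbertTensor H K) where
  toAlgHom := tensorAlgHom π ρ
  map_star' t := by
    change tensorAlgHom π ρ (star t) = star (tensorAlgHom π ρ t)
    induction t with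
    | zero => rw [star_zero, map_zero, star_zero]
    | tmul a b =>
      rw [TensorProduct.star_tmul, tensorAlgHom_tmul, tensorAlgHom_tmul, star_operatorTensor,
        map_star, map_star]
    | add s t hs ht => rw [star_add, map_add, map_add, star_add, hs, ht]

@[simp]
theorem tensorRep_tmul (π : A →⋆ₐ[ℂ] (H →L[ℂ] H)) (ρ : B →⋆ₐ[ℂ] (K →L[ℂ] K)) (a : A) (b : B) :
    tensorRep π ρ (a ⊗ₜ b) = operatorTensor (π a) (ρ b) := rfl

/-- Sums of the operators `π(a) ⊗ ρ(b)` are already closed under products and adjoints. Norms in the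
spatial tensor product can thus be studied on the algebraic tensor product. -/
theorem range_tensorRep (π : A →⋆ₐ[ℂ] (H →L[ℂ] H)) (ρ : B →⋆ₐ[ℂ] (K →L[ℂ] K)) :
    (tensorRep π ρ).range = StarAlgebra.adjoin ℂ
      (Set.range fun p : A × B => operatorTensor (π p.1) (ρ p.2)) := by
  refine le_antisymm ?_ (StarAlgebra.adjoin_le ?_)
  · rintro _ ⟨t, rfl⟩
    change tensorRep π ρ t ∈ _
    induction t with
    | zero => rw [map_zero]; exact zero_mem _
    | tmul a b => exact StarAlgebra.subset_adjoin ℂ _ ⟨(a, b), rfl⟩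
    | add s t hs ht => rw [map_add]; exact add_mem hs ht
  · rintro _ ⟨p, rfl⟩
    exact ⟨p.1 ⊗ₜ p.2, rfl⟩

theorem spatialTensor_eq_range (π : A →⋆ₐ[ℂ] (H →L[ℂ] H)) (ρ : B →⋆ₐ[ℂ] (K →L[ℂ] K)) :
    spatialTensor π ρ = (tensorRep π ρ).range.topologicalClosure := by
  rw [range_tensorRep, spatialTensor]

end TensorRep

/-! ### Matrices over a represented C⋆-algebra -/

section MatrixRep

variable {B : Type v} [CStarAlgebra B] {K : Type v'} [NormedAddCommGroup K]
  [InnerProductSpace ℂ K] [CompleteSpace K] {n : Type w} [Fintype n]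

/-- The action on `Kⁿ` of a matrix over a C⋆-algebra represented on `K`. -/
noncomputable def matrixOperator (ρ : B →⋆ₐ[ℂ] (K →L[ℂ] K)) (M : CStarMatrix n n B) :
    PiLp 2 (fun _ : n => K) →L[ℂ] PiLp 2 (fun _ : n => K) :=
  (PiLp.continuousLinearEquiv 2 ℂ (fun _ : n => K)).symm.toContinuousLinearMap ∘L
    ContinuousLinearMap.pi fun i => ∑ j, ρ (M i j) ∘L PiLp.proj 2 (fun _ : n => K) j

@[simp]
theorem matrixOperator_apply (ρ : B →⋆ₐ[ℂ] (K →L[ℂ] K)) (M : CStarMatrix n n B)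
    (k : PiLp 2 (fun _ : n => K)) (i : n) :
    matrixOperator ρ M k i = ∑ j, ρ (M i j) (k j) := by
  simp [matrixOperator]

/-- The representation on `Kⁿ` of the matrices over a C⋆-algebra represented on `K`. -/
noncomputable def matrixRep (ρ : B →⋆ₐ[ℂ] (K →L[ℂ] K)) :
    CStarMatrix n n B →⋆ₙₐ[ℂ] (PiLp 2 (fun _ : n => K) →L[ℂ] PiLp 2 (fun _ : n => K)) where
  toFun := matrixOperator ρ
  map_smul' c M := by ext k i; simp [Finset.smul_sum]
  map_zero' := by ext k i; simp
  map_add' M N := by ext k i; simp [Finset.sum_add_distrib]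
  map_mul' M N := by
    ext k i
    simp only [matrixOperator_apply, mul_apply_eq_comp, CStarMatrix.mul_apply, map_sum,
      map_mul, sum_apply]
    exact Finset.sum_comm
  map_star' M := by
    rw [ContinuousLinearMap.star_eq_adjoint, ContinuousLinearMap.eq_adjoint_iff]
    intro x y
    simp only [PiLp.inner_apply, matrixOperator_apply, CStarMatrix.star_apply, map_star, inner_sum,
      sum_inner, ContinuousLinearMap.star_eq_adjoint, ContinuousLinearMap.adjoint_inner_left]
    exact Finset.sum_comm

theorem matrixRep_apply (ρ : B →⋆ₐ[ℂ] (K →L[ℂ] K)) (M : CStarMatrix n n B)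
    (k : PiLp 2 (fun _ : n => K)) (i : n) :
    matrixRep ρ M k i = ∑ j, ρ (M i j) (k j) :=
  matrixOperator_apply ρ M k i

/-- Feeding in a vector supported in slot `j` and reading off coordinate `i` recovers `ρ (M i j)`.
-/
theorem matrixRep_injective {ρ : B →⋆ₐ[ℂ] (K →L[ℂ] K)} (hρ : Function.Injective ρ) :
    Function.Injective (matrixRep (n := n) ρ) := by
  classical
  rw [injective_iff_map_eq_zero]
  intro M hM
  refine CStarMatrix.ext fun i j => (injective_iff_map_eq_zero ρ).mp hρ _ ?_
  ext x
  have h : matrixRep ρ M (WithLp.toLp 2 (Pi.single j x)) i = 0 := by rw [hM]; rfl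
  rw [matrixRep_apply, Finset.sum_eq_single j (fun l _ hl => by simp [hl]) (by simp)] at h
  simpa using h

/-- The norm of a matrix over a C⋆-algebra can be computed in every faithful representation. -/
theorem norm_matrixRep_eq {K' : Type u'} [NormedAddCommGroup K'] [InnerProductSpace ℂ K']
    [CompleteSpace K'] {ρ : B →⋆ₐ[ℂ] (K →L[ℂ] K)} {ρ' : B →⋆ₐ[ℂ] (K' →L[ℂ] K')}
    (hρ : Function.Injective ρ) (hρ' : Function.Injective ρ') (M : CStarMatrix n n B) :
    ‖matrixRep ρ M‖ = ‖matrixRep ρ' M‖ := by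
  let _ := CStarAlgebra.spectralOrder B
  have := CStarAlgebra.spectralOrderedRing B
  let _ : NonUnitalCStarAlgebra (PiLp 2 (fun _ : n => K) →L[ℂ] PiLp 2 (fun _ : n => K)) :=
    CStarAlgebra.toNonUnitalCStarAlgebra _
  let _ : NonUnitalCStarAlgebra (PiLp 2 (fun _ : n => K') →L[ℂ] PiLp 2 (fun _ : n => K')) :=
    CStarAlgebra.toNonUnitalCStarAlgebra _
  -- Injective `*`-homomorphisms of C⋆-algebras are isometric, so both sides equal the norm of `M`
  -- itself.
  exact (NonUnitalStarAlgHom.norm_map (matrixRep ρ) (matrixRep_injective hρ) M).trans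
    (NonUnitalStarAlgHom.norm_map (matrixRep ρ') (matrixRep_injective hρ') M).symm

end MatrixRep

/-! ### Copies of `Kⁿ` inside `H ⊗ K` -/

namespace HilbertTensor

variable {H : Type u} {K : Type v} [NormedAddCommGroup H] [InnerProductSpace ℂ H]
  [NormedAddCommGroup K] [InnerProductSpace ℂ K]

theorem norm_sum_tmul {n : Type w} [Fintype n] {e : n → H} (he : Orthonormal ℂ e)
    (k : PiLp 2 (fun _ : n => K)) : ‖ofTensor H K (∑ i, e i ⊗ₜ k i)‖ = ‖k‖ := by
  classical
  rw [@norm_eq_sqrt_re_inner ℂ, @norm_eq_sqrt_re_inner ℂ, LinearIsometry.inner_map_map]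
  congr 2
  simp only [sum_inner, inner_sum, TensorProduct.inner_tmul, orthonormal_iff_ite.mp he,
    PiLp.inner_apply]
  simp

/-- Two elements of `H ⊗ K` are combinations of a common orthonormal family in `H`. -/
theorem exists_orthonormal_sum_tmul (s t : H ⊗[ℂ] K) :
    ∃ (n : ℕ) (e : Fin n → H), Orthonormal ℂ e ∧ ∃ k l : PiLp 2 (fun _ : Fin n => K),
      s = ∑ i, e i ⊗ₜ k i ∧ t = ∑ i, e i ⊗ₜ l i := by
  -- Both tensors live in `H' ⊗ K` for one finite-dimensional `H' ⊆ H`; the family is an orthonormal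
  -- basis of `H'`.
  obtain ⟨H', _, hst⟩ := TensorProduct.exists_finite_submodule_left_of_setFinite {s, t}
    (Set.toFinite _)
  obtain ⟨s', rfl⟩ := hst (Set.mem_insert _ _)
  obtain ⟨t', rfl⟩ := hst (Set.mem_insert_of_mem _ rfl)
  let b := stdOrthonormalBasis ℂ H'
  have key : ∀ r : H' ⊗[ℂ] K, ∃ k : PiLp 2 (fun _ : Fin (Module.finrank ℂ H') => K),
      H'.subtype.rTensor K r = ∑ i, (b i : H) ⊗ₜ k i := fun r => by
    obtain ⟨c, rfl⟩ := TensorProduct.eq_repr_basis_left b.toBasis r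
    refine ⟨WithLp.toLp 2 c, ?_⟩
    rw [Finsupp.sum_fintype _ _ (by simp)]
    simp
  obtain ⟨k, hk⟩ := key s'
  obtain ⟨l, hl⟩ := key t'
  exact ⟨_, fun i => b i, b.orthonormal.comp_linearIsometry H'.subtypeₗᵢ, k, l, hk, hl⟩

end HilbertTensor

/-! ### Independence of the spatial norm from the second representation -/

section Independence

open HilbertTensor

variable {A : Type u} {B : Type v} [CStarAlgebra A] [CStarAlgebra B]
    {H : Type u'} {K : Type v'} [NormedAddCommGroup H] [InnerProductSpace ℂ H] [CompleteSpace H]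
    [NormedAddCommGroup K] [InnerProductSpace ℂ K] [CompleteSpace K]

/-- The matrix over `B` of an element of `A ⊗ B` with respect to a family of vectors in a
representation space of `A`. -/
noncomputable def sliceMatrix {n : Type w} (π : A →⋆ₐ[ℂ] (H →L[ℂ] H)) (e : n → H) :
    A ⊗[ℂ] B →ₗ[ℂ] Matrix n n B :=
  TensorProduct.lift (LinearMap.mk₂ ℂ (fun a b => Matrix.of fun i j => inner ℂ (e i) (π a (e j)) • b)
    (fun a a' b => by ext; simp [add_smul])
    (fun c a b => by ext; simp [mul_smul])
    (fun a b b' => by ext; simp)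
    (fun c a b => by ext; simp [smul_comm c]))

/-- Compressing `tensorRep π ρ t` to the copy of `Kⁿ` given by `e` yields a matrix over `B` that
does not involve `ρ`, with `ρ` applied entrywise. -/
theorem inner_tensorRep {n : Type w} [Fintype n] (π : A →⋆ₐ[ℂ] (H →L[ℂ] H))
    (ρ : B →⋆ₐ[ℂ] (K →L[ℂ] K)) (e : n → H) (t : A ⊗[ℂ] B) (k l : PiLp 2 (fun _ : n => K)) :
    inner ℂ (ofTensor H K (∑ i, e i ⊗ₜ l i)) (tensorRep π ρ t (ofTensor H K (∑ i, e i ⊗ₜ k i))) =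
      inner ℂ l (matrixRep ρ (CStarMatrix.ofMatrix (sliceMatrix π e t)) k) := by
  simp only [PiLp.inner_apply, matrixRep_apply, CStarMatrix.ofMatrix_apply, inner_sum]
  induction t with
  | zero => simp
  | add s t hs ht => simp only [map_add, add_apply, inner_add_right, hs, ht, Matrix.add_apply, Finset.sum_add_distrib]
  | tmul a b =>
    simp only [map_sum, tensorRep_tmul, operatorTensor_tmul, sum_inner, inner_sum, inner_tmul]
    rw [Finset.sum_comm]
    simp [sliceMatrix, inner_smul_right]

/-- For orthonormal `e` this is compression along an isometry `Kⁿ → H ⊗ K`, which cannot increase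
the norm. -/
theorem norm_matrixRep_le {n : Type w} [Fintype n] (π : A →⋆ₐ[ℂ] (H →L[ℂ] H))
    (ρ : B →⋆ₐ[ℂ] (K →L[ℂ] K)) {e : n → H} (he : Orthonormal ℂ e) (t : A ⊗[ℂ] B) :
    ‖matrixRep ρ (CStarMatrix.ofMatrix (sliceMatrix π e t))‖ ≤ ‖tensorRep π ρ t‖ := by
  refine ContinuousLinearMap.opNorm_le_of_re_inner_le (norm_nonneg _) fun k l hk hl => ?_
  rw [inner_re_symm, ← inner_tensorRep]
  refine (re_inner_le_norm _ _).trans ?_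
  rw [norm_sum_tmul he, hl, one_mul]
  refine ((tensorRep π ρ t).le_opNorm _).trans ?_
  rw [norm_sum_tmul he, hk, mul_one]

/-- Algebraic tensors are dense, and any two of them lie in a common copy of `Kⁿ`, so bounds on all
compressions bound the whole sesquilinear form. -/
theorem norm_tensorRep_le (π : A →⋆ₐ[ℂ] (H →L[ℂ] H)) (ρ : B →⋆ₐ[ℂ] (K →L[ℂ] K)) (t : A ⊗[ℂ] B)
    {C : ℝ} (hC : 0 ≤ C) (h : ∀ (n : ℕ) (e : Fin n → H), Orthonormal ℂ e →
      ‖matrixRep ρ (CStarMatrix.ofMatrix (sliceMatrix π e t))‖ ≤ C) :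
    ‖tensorRep π ρ t‖ ≤ C := by
  have key : ∀ x y : HilbertTensor H K,
      ‖inner ℂ y (tensorRep π ρ t x)‖ ≤ C * ‖x‖ * ‖y‖ := by
    intro x y
    induction x using denseRange_ofTensor.induction_on with
    | hp => exact isClosed_le (by fun_prop) (by fun_prop)
    | ih r =>
    induction y using denseRange_ofTensor.induction_on with
    | hp => exact isClosed_le (by fun_prop) (by fun_prop)
    | ih s =>
    obtain ⟨n, e, he, k, l, rfl, rfl⟩ := exists_orthonormal_sum_tmul r s
    rw [inner_tensorRep, norm_sum_tmul he, norm_sum_tmul he, mul_comm _ ‖l‖]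
    refine (norm_inner_le_norm _ _).trans ?_
    gcongr
    exact ContinuousLinearMap.le_of_opNorm_le _ (h n e he) k
  refine ContinuousLinearMap.opNorm_le_of_re_inner_le hC fun x y hx hy => ?_
  rw [inner_re_symm]
  simpa [hx, hy] using (Complex.re_le_norm _).trans (key x y)

theorem norm_tensorRep_eq {K' : Type w} [NormedAddCommGroup K'] [InnerProductSpace ℂ K']
    [CompleteSpace K'] (π : A →⋆ₐ[ℂ] (H →L[ℂ] H)) {ρ : B →⋆ₐ[ℂ] (K →L[ℂ] K)}
    {ρ' : B →⋆ₐ[ℂ] (K' →L[ℂ] K')} (hρ : Function.Injective ρ) (hρ' : Function.Injective ρ')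
    (t : A ⊗[ℂ] B) : ‖tensorRep π ρ t‖ = ‖tensorRep π ρ' t‖ := by
  refine le_antisymm ?_ ?_
  · refine norm_tensorRep_le π ρ t (norm_nonneg _) fun n e he => ?_
    rw [norm_matrixRep_eq hρ hρ']
    exact norm_matrixRep_le π ρ' he t
  · refine norm_tensorRep_le π ρ' t (norm_nonneg _) fun n e he => ?_
    rw [norm_matrixRep_eq hρ' hρ]
    exact norm_matrixRep_le π ρ he t

/-- The spatial tensor product does not depend on the faithful representation of the second
factor. -/
theorem nonempty_spatialTensor_starAlgEquiv {K' : Type w} [NormedAddCommGroup K']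
    [InnerProductSpace ℂ K'] [CompleteSpace K'] (π : A →⋆ₐ[ℂ] (H →L[ℂ] H))
    {ρ : B →⋆ₐ[ℂ] (K →L[ℂ] K)} {ρ' : B →⋆ₐ[ℂ] (K' →L[ℂ] K')} (hρ : Function.Injective ρ)
    (hρ' : Function.Injective ρ') :
    Nonempty (spatialTensor π ρ ≃⋆ₐ[ℂ] spatialTensor π ρ') := by
  rw [spatialTensor_eq_range, spatialTensor_eq_range]
  exact StarAlgHom.nonempty_starAlgEquiv_of_norm_eq _ _ (norm_tensorRep_eq π hρ hρ')

/-- The minimal tensor product can be formed in every faithful representation of the second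
factor. -/
theorem nonempty_starAlgEquiv_minTensor {ρ : B →⋆ₐ[ℂ] (K →L[ℂ] K)} (hρ : Function.Injective ρ) :
    Nonempty (spatialTensor (universalRep A) ρ ≃⋆ₐ[ℂ] MinTensor A B) :=
  nonempty_spatialTensor_starAlgEquiv (universalRep A) hρ (universalRep_injective B)

end Independence

/-! ### The scalar 2-cocycle -/

section Cocycle

variable {A : Type u} [CStarAlgebra A] {G : Type v} [Group G]

/-- Central unitaries of a C⋆-algebra with trivial center are scalars of modulus one. -/
theorem exists_circle_of_commute [Nontrivial A] (hA : Subalgebra.center ℂ A = ⊥) (z : unitary A)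
    (hz : ∀ a : A, (z : A) * a = a * z) : ∃ c : Circle, (z : A) = (c : ℂ) • 1 := by
  have hmem : (z : A) ∈ Subalgebra.center ℂ A :=
    Subalgebra.mem_center_iff.mpr fun a => (hz a).symm
  rw [hA, Algebra.mem_bot] at hmem
  obtain ⟨c, hc⟩ := hmem
  have hnorm : ‖c‖ = 1 := by
    rw [← norm_algebraMap' A c, hc, CStarRing.norm_coe_unitary]
  exact ⟨⟨c, mem_sphere_zero_iff_norm.mpr hnorm⟩, by
    rw [← hc, Algebra.algebraMap_eq_smul_one]⟩

/-- A pointwise inner twisted action on a C⋆-algebra with trivial center is implemented by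
unitaries, projectively multiplicative up to the twist and a scalar cocycle. -/
theorem TwistedAction.PointwiseInner.exists_twoCocycle {T : TwistedAction G A}
    (hT : T.PointwiseInner) (hA : Subalgebra.center ℂ A = ⊥) :
    ∃ (v : G → unitary A) (σ : TwoCocycle G),
      (∀ s a, T.aut s a = (v s : A) * a * star (v s : A)) ∧
      ∀ s t, (T.cocycle s t : A) * v (s * t) = (σ.toFun s t : ℂ) • ((v s : A) * v t) := by
  classical
  -- In the zero algebra scalars cannot be recovered from their multiples of `1`, but the trivial
  -- cocycle works.
  rcases subsingleton_or_nontrivial A with hsub | hnt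
  · exact ⟨1, ⟨1, by simp, by simp, by simp⟩, fun _ _ => Subsingleton.elim _ _,
      fun _ _ => Subsingleton.elim _ _⟩
  choose v₀ hv₀ using hT
  -- Resetting `v 1` to `1` is allowed because `α_e = id`; it makes `σ` normalized.
  let v : G → unitary A := Function.update v₀ 1 1
  have hv1 : v 1 = 1 := Function.update_self ..
  have hv : ∀ s a, T.aut s a = (v s : A) * a * star (v s : A) := fun s a => by
    by_cases hs : s = 1
    · subst hs; simp [hv1, T.aut_one]
    · simp [v, Function.update_of_ne hs, hv₀]
  have hstar : ∀ u : unitary A, star (u : A) * u = 1 := fun u => Unitary.star_mul_self_of_mem u.2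
  have hstar' : ∀ u : unitary A, (u : A) * star (u : A) = 1 :=
    fun u => Unitary.mul_star_self_of_mem u.2
  -- With `p = v_s v_t` and `q = ω(s,t) v_{st}`, the action axiom says `Ad p = Ad q`, so `q p*` is
  -- central.
  have hcomm : ∀ s t (a : A),
      ((T.cocycle s t * v (s * t) * star (v s * v t) : unitary A) : A) * a =
        a * (T.cocycle s t * v (s * t) * star (v s * v t) : unitary A) := fun s t a => by
    set p : unitary A := v s * v t with hp
    set q : unitary A := T.cocycle s t * v (s * t) with hq
    have h : ∀ b : A, (p : A) * b * star (p : A) = q * b * star (q : A) := fun b => by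
      have := T.aut_aut s t b
      simp only [hv] at this
      simpa [hp, hq, mul_assoc] using this
    have h1 := h (star (p : A) * a * p)
    have h2 : (p : A) * (star (p : A) * a * p) * star (p : A) = a := by
      rw [mul_assoc, mul_assoc, hstar', mul_one, ← mul_assoc, hstar', one_mul]
    rw [h2] at h1
    have h3 := congrArg (fun x => x * ((q : A) * star (p : A))) h1
    simp only [Submonoid.coe_mul, Unitary.coe_star]
    rw [h3]
    simp only [mul_assoc]
    rw [← mul_assoc (star (q : A)) q, hstar, one_mul, hstar', mul_one]
  choose σ hσ using fun s t => exists_circle_of_commute hA _ (hcomm s t)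
  have key : ∀ s t, (T.cocycle s t : A) * v (s * t) = (σ s t : ℂ) • ((v s : A) * v t) :=
    fun s t => by
      have h := congrArg (fun x => x * ((v s : A) * v t)) (hσ s t)
      simpa [mul_assoc, ← mul_assoc (star (v s : A)), hstar,
        ← mul_assoc (star (v t : A)) (v t : A)] using h
  have cancel : ∀ (c d : Circle) (u : unitary A), (c : ℂ) • (u : A) = (d : ℂ) • (u : A) → c = d :=
    fun c d u h => by
      have hu : (u : A) ≠ 0 := fun h0 => by
        have := hstar u
        rw [h0, mul_zero] at this
        exact zero_ne_one this
      exact Circle.ext (smul_left_injective ℂ hu h)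
  refine ⟨v, ⟨σ, fun r s t => ?_, fun s => ?_, fun s => ?_⟩, hv, key⟩
  -- Multiplying the twist identity by `v (r * s * t)` turns each side into a scalar multiple of `v
  -- r * v s * v t`. On the right, `α_r = Ad (v r)` is used to move `v r` past `ω(s,t)`.
  · refine cancel _ _ (v r * v s * v t) ?_
    have h := congrArg (fun x => x * (v (r * s * t) : A)) (T.cocycle_mul r s t)
    have hl : (T.cocycle r s : A) * T.cocycle (r * s) t * v (r * s * t) =
        (σ r s * σ (r * s) t : Circle) • ((v r : A) * v s * v t) := by
      rw [mul_assoc, key, mul_smul_comm, ← mul_assoc, key, smul_mul_assoc, smul_smul, mul_comm]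
      rfl
    have hr : T.aut r (T.cocycle s t : A) * T.cocycle r (s * t) * v (r * s * t) =
        (σ s t * σ r (s * t) : Circle) • ((v r : A) * v s * v t) := by
      rw [hv, mul_assoc r s t, mul_assoc _ _ (v (r * (s * t)) : A), key, mul_smul_comm, mul_assoc,
        ← mul_assoc (star (v r : A)), hstar, one_mul, mul_assoc, key, mul_smul_comm, smul_smul,
        mul_comm, ← mul_assoc]
      rfl
    exact hl.symm.trans (h.trans hr)
  · refine cancel _ _ (v s) ?_
    simpa [T.cocycle_one_left, hv1] using (key 1 s).symm
  · refine cancel _ _ (v s) ?_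
    simpa [T.cocycle_one_right, hv1] using (key s 1).symm

end Cocycle

/-! ### Conjugation by unitary operators -/

namespace LinearIsometryEquiv

variable {E : Type u} {F : Type v} [NormedAddCommGroup E] [InnerProductSpace ℂ E] [CompleteSpace E]
  [NormedAddCommGroup F] [InnerProductSpace ℂ F] [CompleteSpace F]

/-- Conjugation by a unitary operator, as a `*`-homomorphism. -/
noncomputable def conjStarAlgHom (e : E ≃ₗᵢ[ℂ] F) : (E →L[ℂ] E) →⋆ₐ[ℂ] (F →L[ℂ] F) where
  toFun S := e.conjStarAlgEquiv S
  map_one' := by ext x; simp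
  map_mul' S T := by ext x; simp
  map_zero' := by ext x; simp
  map_add' S T := by ext x; simp
  commutes' c := by ext x; simp [Algebra.algebraMap_eq_smul_one]
  map_star' := map_star e.conjStarAlgEquiv

@[simp]
theorem conjStarAlgHom_apply (e : E ≃ₗᵢ[ℂ] F) (S : E →L[ℂ] E) (x : F) :
    e.conjStarAlgHom S x = e (S (e.symm x)) := rfl

theorem norm_conjStarAlgHom (e : E ≃ₗᵢ[ℂ] F) (S : E →L[ℂ] E) : ‖e.conjStarAlgHom S‖ = ‖S‖ := by
  refine NonUnitalStarAlgHom.norm_map e.conjStarAlgHom (fun S T h => ?_) S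
  ext x
  simpa using DFunLike.congr_fun h (e x)

/-- A concrete C⋆-algebra is isomorphic to its conjugate by a unitary operator. -/
theorem nonempty_starAlgEquiv_map_conj (e : E ≃ₗᵢ[ℂ] F) (S : StarSubalgebra ℂ (E →L[ℂ] E)) :
    Nonempty (S.topologicalClosure ≃⋆ₐ[ℂ] (S.map e.conjStarAlgHom).topologicalClosure) :=
  StarSubalgebra.nonempty_starAlgEquiv_topologicalClosure_map S e.conjStarAlgHom
    fun x _ => e.norm_conjStarAlgHom x

end LinearIsometryEquiv

/-! ### The untwisting unitary `H ⊗ ℓ²(G) ≅ ℓ²(G, H)` -/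

namespace HilbertTensor

variable {G : Type v} {H : Type u} [NormedAddCommGroup H] [InnerProductSpace ℂ H]

/-- The element `(f(h) u_h x)_h` of `ℓ²(G, H)`. -/
noncomputable def twistedTmul (u : G → H ≃ₗᵢ[ℂ] H) (x : H) (f : lp (fun _ : G => ℂ) 2) :
    lp (fun _ : G => H) 2 :=
  ⟨fun h => f h • u h x, by
    refine memℓp_gen ?_
    have hf : Summable fun h => ‖f h‖ ^ (2 : ℝ≥0∞).toReal := (lp.memℓp f).summable (by simp)
    refine (hf.mul_right (‖x‖ ^ (2 : ℝ≥0∞).toReal)).congr fun h => ?_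
    rw [norm_smul, LinearIsometryEquiv.norm_map, Real.mul_rpow (norm_nonneg _) (norm_nonneg _)]⟩

@[simp]
theorem twistedTmul_apply (u : G → H ≃ₗᵢ[ℂ] H) (x : H) (f : lp (fun _ : G => ℂ) 2) (h : G) :
    twistedTmul u x f h = f h • u h x := rfl

/-- Each `u h` preserves inner products, so `⟨x, y⟩` factors out of the sum over `h`. -/
theorem inner_twistedTmul (u : G → H ≃ₗᵢ[ℂ] H) (x y : H) (f g : lp (fun _ : G => ℂ) 2) :
    inner ℂ (twistedTmul u x f) (twistedTmul u y g) = inner ℂ x y * inner ℂ f g := by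
  rw [lp.inner_eq_tsum, lp.inner_eq_tsum, ← tsum_mul_left]
  refine tsum_congr fun h => ?_
  simp [inner_smul_left, inner_smul_right]
  ring

/-- The linear map `x ⊗ f ↦ (f(h) u_h x)_h` on the algebraic tensor product. -/
noncomputable def twistedLinearMap (u : G → H ≃ₗᵢ[ℂ] H) :
    H ⊗[ℂ] lp (fun _ : G => ℂ) 2 →ₗ[ℂ] lp (fun _ : G => H) 2 :=
  TensorProduct.lift (LinearMap.mk₂ ℂ (twistedTmul u)
    (fun x y f => by ext h; simp)
    (fun c x f => by ext h; simp [smul_comm c])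
    (fun x f g => by ext h; simp [add_smul])
    (fun c x f => by ext h; simp [mul_smul]))

/-- The isometry `x ⊗ f ↦ (f(h) u_h x)_h` on the algebraic tensor product. -/
noncomputable def twistedIsometry (u : G → H ≃ₗᵢ[ℂ] H) :
    H ⊗[ℂ] lp (fun _ : G => ℂ) 2 →ₗᵢ[ℂ] lp (fun _ : G => H) 2 :=
  (twistedLinearMap u).isometryOfInner fun s t => by
    induction s with
    | zero => simp
    | add s s' hs hs' => simp only [map_add, inner_add_left, hs, hs']
    | tmul x f =>
      induction t with
      | zero => simp
      | add t t' ht ht' => simp only [map_add, inner_add_right, ht, ht']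
      | tmul y g => exact (inner_twistedTmul u x y f g).trans (TensorProduct.inner_tmul ..).symm

variable [CompleteSpace H]

/-- The bounded operator `x ⊗ f ↦ (f(h) u_h x)_h` from `H ⊗ ℓ²(G)` to `ℓ²(G, H)`. -/
noncomputable def twistedCLM (u : G → H ≃ₗᵢ[ℂ] H) :
    HilbertTensor H (lp (fun _ : G => ℂ) 2) →L[ℂ] lp (fun _ : G => H) 2 :=
  (twistedIsometry u).toContinuousLinearMap.fromCompletion

theorem twistedCLM_ofTensor (u : G → H ≃ₗᵢ[ℂ] H) (t : H ⊗[ℂ] lp (fun _ : G => ℂ) 2) :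
    twistedCLM u (ofTensor _ _ t) = twistedIsometry u t :=
  ContinuousLinearMap.fromCompletion_apply_coe _ t

theorem twistedCLM_tmul (u : G → H ≃ₗᵢ[ℂ] H) (x : H) (f : lp (fun _ : G => ℂ) 2) :
    twistedCLM u (ofTensor _ _ (x ⊗ₜ f)) = twistedTmul u x f :=
  twistedCLM_ofTensor u _

theorem norm_twistedCLM (u : G → H ≃ₗᵢ[ℂ] H) (z : HilbertTensor H (lp (fun _ : G => ℂ) 2)) :
    ‖twistedCLM u z‖ = ‖z‖ := by
  induction z using denseRange_ofTensor.induction_on with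
  | hp => exact isClosed_eq (by fun_prop) (by fun_prop)
  | ih t => rw [twistedCLM_ofTensor, LinearIsometry.norm_map, LinearIsometry.norm_map]

/-- The range is closed and contains every vector `y` placed at `h`, as the image of `(u h)⁻¹ y ⊗
δ_h`; finite sums of these converge to any `ξ`. -/
theorem twistedCLM_surjective (u : G → H ≃ₗᵢ[ℂ] H) : Function.Surjective (twistedCLM u) := by
  classical
  intro ξ
  have hiso : Isometry (twistedCLM u) :=
    AddMonoidHomClass.isometry_of_norm _ (norm_twistedCLM u)
  have hsingle : ∀ h (y : H), lp.single (E := fun _ : G => H) 2 h y =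
      twistedCLM u (ofTensor _ _ ((u h).symm y ⊗ₜ lp.single 2 h 1)) := fun h y => by
    rw [twistedCLM_tmul]
    ext i
    by_cases hi : i = h
    · subst hi; simp
    · simp [hi]
  have hmem : ∀ s : Finset G, ∑ h ∈ s, lp.single (E := fun _ : G => H) 2 h (ξ h) ∈
      (twistedCLM u).range := fun s =>
    sum_mem fun h _ => ⟨_, (hsingle h (ξ h)).symm⟩
  exact hiso.isClosedEmbedding.isClosed_range.mem_of_tendsto
    (lp.hasSum_single (by simp) ξ) (Filter.Eventually.of_forall hmem)

/-- The unitary operator `x ⊗ f ↦ (f(h) u_h x)_h` from `H ⊗ ℓ²(G)` onto `ℓ²(G, H)`. -/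
noncomputable def twistedEquiv (u : G → H ≃ₗᵢ[ℂ] H) :
    HilbertTensor H (lp (fun _ : G => ℂ) 2) ≃ₗᵢ[ℂ] lp (fun _ : G => H) 2 :=
  LinearIsometryEquiv.ofSurjective
    { toLinearMap := (twistedCLM u).toLinearMap, norm_map' := norm_twistedCLM u }
    (twistedCLM_surjective u)

theorem twistedEquiv_tmul (u : G → H ≃ₗᵢ[ℂ] H) (x : H) (f : lp (fun _ : G => ℂ) 2) :
    twistedEquiv u (ofTensor _ _ (x ⊗ₜ f)) = twistedTmul u x f :=
  twistedCLM_tmul u x f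

/-- Two operators correspond under `twistedEquiv` if they are intertwined on pure tensors. -/
theorem conjStarAlgHom_twistedEquiv_eq (u : G → H ≃ₗᵢ[ℂ] H)
    {S : HilbertTensor H (lp (fun _ : G => ℂ) 2) →L[ℂ] HilbertTensor H (lp (fun _ : G => ℂ) 2)}
    {R : lp (fun _ : G => H) 2 →L[ℂ] lp (fun _ : G => H) 2}
    (h : ∀ x f, twistedEquiv u (S (ofTensor _ _ (x ⊗ₜ f))) = R (twistedTmul u x f)) :
    (twistedEquiv u).conjStarAlgHom S = R := by
  have key : (twistedEquiv u).toContinuousLinearEquiv.toContinuousLinearMap ∘L S =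
      R ∘L (twistedEquiv u).toContinuousLinearEquiv.toContinuousLinearMap :=
    ext_tmul fun x f => (h x f).trans (congrArg R (twistedEquiv_tmul u x f).symm)
  ext1 ξ
  obtain ⟨z, rfl⟩ := (twistedEquiv u).surjective ξ
  rw [LinearIsometryEquiv.conjStarAlgHom_apply, LinearIsometryEquiv.symm_apply_apply]
  exact DFunLike.congr_fun key z

variable (H) in
/-- The representation `T ↦ 1 ⊗ T`. -/
noncomputable def amplification (K : Type w) [NormedAddCommGroup K] [InnerProductSpace ℂ K]
    [CompleteSpace K] :
    (K →L[ℂ] K) →⋆ₐ[ℂ] (HilbertTensor H K →L[ℂ] HilbertTensor H K) where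
  toFun T := operatorTensor 1 T
  map_one' := operatorTensor_one
  map_mul' S T := by rw [← operatorTensor_mul, one_mul]
  map_zero' := by simpa using operatorTensor_smul_right 0 (1 : H →L[ℂ] H) (0 : K →L[ℂ] K)
  map_add' S T := operatorTensor_add_right _ _ _
  commutes' c := by
    rw [Algebra.algebraMap_eq_smul_one, operatorTensor_smul_right, operatorTensor_one,
      Algebra.algebraMap_eq_smul_one]
  map_star' T := by rw [star_operatorTensor, star_one]

end HilbertTensor

/-- The defining representation of the reduced twisted group C⋆-algebra on `ℓ²(G)`. -/
noncomputable def TwoCocycle.regularInclusion {G : Type v} [Group G] (σ : TwoCocycle G) :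
    σ.GroupCStar →⋆ₐ[ℂ] (lp (fun _ : G => ℂ) 2 →L[ℂ] lp (fun _ : G => ℂ) 2) :=
  StarSubalgebra.subtype (σ.twistedAction.regularAlgebra (StarAlgHom.ofId ℂ (ℂ →L[ℂ] ℂ)))

theorem TwoCocycle.regularInclusion_injective {G : Type v} [Group G] (σ : TwoCocycle G) :
    Function.Injective σ.regularInclusion := Subtype.val_injective

/-! ### Untwisting the crossed product -/

namespace TwistedAction

open HilbertTensor

variable {A : Type u} [CStarAlgebra A] {G : Type v} [Group G] {H : Type w}
  [NormedAddCommGroup H] [InnerProductSpace ℂ H] [CompleteSpace H]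

/-- The unitary operators `π(v_{h⁻¹})`. -/
noncomputable def implementing (π : A →⋆ₐ[ℂ] (H →L[ℂ] H)) (v : G → unitary A) (h : G) :
    H ≃ₗᵢ[ℂ] H :=
  Unitary.linearIsometryEquiv ⟨π (v h⁻¹ : A), Unitary.map_mem π (v h⁻¹).2⟩

/-- At coordinate `h` this is `v_{h⁻¹} a = α_{h⁻¹}(a) v_{h⁻¹}`, which is why `implementing` uses
`h⁻¹`. -/
theorem conj_operatorTensor_one (T : TwistedAction G A) {v : G → unitary A}
    (hv : ∀ s a, T.aut s a = (v s : A) * a * star (v s : A))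
    (π : A →⋆ₐ[ℂ] (H →L[ℂ] H)) (a : A) :
    (twistedEquiv (implementing π v)).conjStarAlgHom (operatorTensor (π a) 1) =
      T.regularRep π a := by
  refine conjStarAlgHom_twistedEquiv_eq (implementing π v) fun x f => ?_
  rw [operatorTensor_tmul, twistedEquiv_tmul]
  ext h
  change f h • π (v h⁻¹ : A) (π a x) = π (T.aut h⁻¹ a) (f h • π (v h⁻¹ : A) x)
  rw [map_smul, ← mul_apply_eq_comp, ← mul_apply_eq_comp, ← map_mul, ← map_mul, hv, mul_assoc,
    Unitary.star_mul_self_of_mem (v h⁻¹).2, mul_one]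

/-- At coordinate `h` this is the relation `hσ` with `s = h⁻¹` and `t = g`; the factor `v_g`
appearing there forces `π(v_g)` on the first leg. -/
theorem conj_operatorTensor_regularUnitary (T : TwistedAction G A) {v : G → unitary A}
    {σ : TwoCocycle G}
    (hσ : ∀ s t, (T.cocycle s t : A) * v (s * t) = (σ.toFun s t : ℂ) • ((v s : A) * v t))
    (π : A →⋆ₐ[ℂ] (H →L[ℂ] H)) (g : G) :
    (twistedEquiv (implementing π v)).conjStarAlgHom (operatorTensor (π (v g : A))
      (σ.twistedAction.regularUnitary (StarAlgHom.ofId ℂ (ℂ →L[ℂ] ℂ)) g)) =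
      T.regularUnitary π g := by
  refine conjStarAlgHom_twistedEquiv_eq (implementing π v) fun x f => ?_
  rw [operatorTensor_tmul, twistedEquiv_tmul]
  ext h
  change ((σ.toFun h⁻¹ g : ℂ) * f (g⁻¹ * h)) • π (v h⁻¹ : A) (π (v g : A) x) =
    π (T.cocycle h⁻¹ g : A) (f (g⁻¹ * h) • π (v (g⁻¹ * h)⁻¹ : A) x)
  rw [map_smul, ← mul_apply_eq_comp, ← mul_apply_eq_comp, ← map_mul, ← map_mul, mul_inv_rev,
    inv_inv, hσ, map_smul, smul_apply, smul_smul, mul_comm]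

/-- A pointwise inner twisted crossed product is unitarily equivalent to a spatial tensor
product. -/
theorem topologicalClosure_map_range_tensorRep (T : TwistedAction G A) {v : G → unitary A}
    {σ : TwoCocycle G} (hv : ∀ s a, T.aut s a = (v s : A) * a * star (v s : A))
    (hσ : ∀ s t, (T.cocycle s t : A) * v (s * t) = (σ.toFun s t : ℂ) • ((v s : A) * v t))
    (π : A →⋆ₐ[ℂ] (H →L[ℂ] H)) :
    ((tensorRep π σ.regularInclusion).range.map
        (twistedEquiv (implementing π v)).conjStarAlgHom).topologicalClosure =
      T.regularAlgebra π := by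
  set e := (twistedEquiv (implementing π v)).conjStarAlgHom
  have hrep : ∀ a, T.regularRep π a ∈ T.regularAlgebra π := fun a =>
    StarSubalgebra.le_topologicalClosure _ (StarAlgebra.subset_adjoin ℂ _ (Or.inl ⟨a, rfl⟩))
  have hunit : ∀ g, T.regularUnitary π g ∈ T.regularAlgebra π := fun g =>
    StarSubalgebra.le_topologicalClosure _ (StarAlgebra.subset_adjoin ℂ _ (Or.inr ⟨g, rfl⟩))
  -- `θ(b) = U (1 ⊗ b) U*`. It suffices to check on generators that `θ` maps `C*_r(G, σ)` into the
  -- crossed product, since `θ` is continuous and the target closed.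
  let θ : (lp (fun _ : G => ℂ) 2 →L[ℂ] lp (fun _ : G => ℂ) 2) →⋆ₐ[ℂ]
      (lp (fun _ : G => H) 2 →L[ℂ] lp (fun _ : G => H) 2) :=
    e.comp (amplification H (lp (fun _ : G => ℂ) 2))
  have hθ : σ.twistedAction.regularAlgebra (StarAlgHom.ofId ℂ (ℂ →L[ℂ] ℂ)) ≤
      (T.regularAlgebra π).comap θ := by
    have hcont : Continuous θ :=
      AddMonoidHomClass.continuous_of_bound θ 1 fun S => by
        simpa using NonUnitalStarAlgHom.norm_apply_le θ S
    refine StarSubalgebra.topologicalClosure_minimal (StarAlgebra.adjoin_le ?_)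
      (T.isClosed_regularAlgebra π |>.preimage hcont)
    rintro _ (⟨c, rfl⟩ | ⟨g, rfl⟩)
    · have hc : σ.twistedAction.regularRep (StarAlgHom.ofId ℂ (ℂ →L[ℂ] ℂ)) c =
          algebraMap ℂ _ c := by
        ext f h
        rfl
      change θ _ ∈ T.regularAlgebra π
      rw [hc, AlgHomClass.commutes]
      exact algebraMap_mem _ c
    -- Cancel the first leg: `1 ⊗ λ_σ(g) = (π(v_g)* ⊗ 1)(π(v_g) ⊗ λ_σ(g))`.
    · have hg : θ (σ.twistedAction.regularUnitary (StarAlgHom.ofId ℂ (ℂ →L[ℂ] ℂ)) g) =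
          T.regularRep π (star (v g : A)) * T.regularUnitary π g := by
        rw [← T.conj_operatorTensor_one hv, ← T.conj_operatorTensor_regularUnitary hσ, ← map_mul,
          ← operatorTensor_mul, ← map_mul, Unitary.star_mul_self_of_mem (v g).2, map_one, one_mul]
        rfl
      change θ _ ∈ T.regularAlgebra π
      rw [hg]
      exact mul_mem (hrep _) (hunit _)
  rw [range_tensorRep, StarAlgHom.map_adjoin]
  refine le_antisymm ?_ ?_
  · refine StarSubalgebra.topologicalClosure_minimal (StarAlgebra.adjoin_le ?_)
      (T.isClosed_regularAlgebra π)
    rintro _ ⟨_, ⟨⟨a, b⟩, rfl⟩, rfl⟩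
    -- Factor `π(a) ⊗ b = (π(a) ⊗ 1)(1 ⊗ b)`.
    have hab : e (operatorTensor (π a) (b : lp (fun _ : G => ℂ) 2 →L[ℂ] lp (fun _ : G => ℂ) 2)) =
        T.regularRep π a * θ b := by
      rw [← T.conj_operatorTensor_one hv]
      change _ = e _ * e (operatorTensor 1 _)
      rw [← map_mul, ← operatorTensor_mul, one_mul, mul_one]
    change e (operatorTensor (π a) (b : lp (fun _ : G => ℂ) 2 →L[ℂ] lp (fun _ : G => ℂ) 2)) ∈ _
    rw [hab]
    exact mul_mem (hrep a) (hθ b.2)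
  -- Conversely, each generator is the conjugate of a single elementary tensor: `a ⊗ 1` or `v_g ⊗
  -- λ_σ(g)`.
  · refine StarSubalgebra.topologicalClosure_mono (StarAlgebra.adjoin_le ?_)
    rintro _ (⟨a, rfl⟩ | ⟨g, rfl⟩)
    · refine StarAlgebra.subset_adjoin ℂ _ ⟨_, ⟨(a, 1), rfl⟩, ?_⟩
      exact T.conj_operatorTensor_one hv π a
    · refine StarAlgebra.subset_adjoin ℂ _ ⟨_, ⟨((v g : A), ⟨_,
        StarSubalgebra.le_topologicalClosure _
          (StarAlgebra.subset_adjoin ℂ _ (Or.inr ⟨g, rfl⟩))⟩), rfl⟩, ?_⟩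
      exact T.conj_operatorTensor_regularUnitary hσ π g

/-- A pointwise inner twisted crossed product is isomorphic to a spatial tensor product. -/
theorem nonempty_regularAlgebra_starAlgEquiv (T : TwistedAction G A) {v : G → unitary A}
    {σ : TwoCocycle G} (hv : ∀ s a, T.aut s a = (v s : A) * a * star (v s : A))
    (hσ : ∀ s t, (T.cocycle s t : A) * v (s * t) = (σ.toFun s t : ℂ) • ((v s : A) * v t))
    (π : A →⋆ₐ[ℂ] (H →L[ℂ] H)) :
    Nonempty (T.regularAlgebra π ≃⋆ₐ[ℂ] spatialTensor π σ.regularInclusion) := by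
  have h := (twistedEquiv (implementing π v)).nonempty_starAlgEquiv_map_conj
    (tensorRep π σ.regularInclusion).range
  rw [T.topologicalClosure_map_range_tensorRep hv hσ π] at h
  rw [spatialTensor_eq_range]
  exact h.map StarAlgEquiv.symm

end TwistedAction

theorem mainTheorem10 {A : Type u} [CStarAlgebra A] {G : Type v} [Group G]
    (hA : Subalgebra.center ℂ A = ⊥) (hG : IsAmenable G)
    (T : TwistedAction G A) (hT : T.PointwiseInner) :
    ∃ σ : TwoCocycle G, Nonempty (T.CrossedProduct ≃⋆ₐ[ℂ] MinTensor A σ.GroupCStar) := by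
  obtain ⟨v, σ, hv, hσ⟩ := hT.exists_twoCocycle hA
  obtain ⟨e₁⟩ := T.nonempty_regularAlgebra_starAlgEquiv hv hσ (universalRep A)
  -- Passes from `C*_r(G, σ)` acting on `ℓ²(G)` to its universal representation.
  obtain ⟨e₂⟩ := nonempty_starAlgEquiv_minTensor (A := A) σ.regularInclusion_injective
  exact ⟨σ, ⟨e₁.trans e₂⟩⟩
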